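/- Let $\Theta\subseteq\mathbb{R}^k$ be open and let $\theta^0\in\Theta$. Let $A:\Theta\to\mathbb{R}^d$ ($k\le d$), let $M(\theta)\in\mathbb{R}^{d\times d}$ be symmetric positive semidefinite for $\theta\in\Theta$, and let $C(\theta)\in\mathbb{R}^{d\times d}$ be a covariance (symmetric positive semidefinite) matrix for $\theta\in\Theta$. Assume: 1. $A$ is bicontinuous: for $\theta\in\Theta$ and any sequence $(\theta_j)$ in $\Theta$, $\theta_j\to\theta$ if and only if $A(\theta_j)\to A(\theta)$; 2. $A$ has continuous first partial derivatives on $\Theta$, and its Jacobian matrix $\dot A(\theta)\in\mathbb{R}^{d\times k}$ has full rank $k$ for every $\theta\in\Theta$; 3. $M$ is continuous on $\Theta$ and there is $\eta>0$ such that $M(\theta)-\eta I_d$ is positive definite for all $\theta$ in a neighborhood of $\theta^0$. Let $V^{(n)}$, $n\ge1$, be random vectors in $\mathbb{R}^d$ on a probability space with $$\sqrt n\,\bigl(V^{(n)}-A(\theta^0)\bigr)\xrightarrow{D}N\bigl(0,C(\theta^0)\bigr),$$ and let $\phi_n:\mathbb{R}^d\to\mathbb{R}^k$ be measurable functions (for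 example a single function $\phi_n=\phi$) such that $\phi_n(V^{(n)})\to\theta^0$ in probability. Put $$\hat R^{(n)}(\theta)=n\,\bigl(V^{(n)}-A(\theta)\bigr)^\top M\bigl(\phi_n(V^{(n)})\bigr)\bigl(V^{(n)}-A(\theta)\bigr),\qquad\theta\in\Theta,$$ where $M(\phi_n(V^{(n)}))$ is given arbitrary values on the event $\phi_n(V^{(n)})\notin\Theta$, whose probability tends to $0$. Let $\hat\theta^{(n)}$ be a random vector in $\mathbb{R}^k$ such that, for every $n\ge1$, almost surely, $\hat\theta^{(n)}$ is a minimizer of $\hat R^{(n)}$ over $\Theta$ whenever such a minimizer exists. Then a minimizer of $\hat R^{(n)}$ over $\Theta$ exists with probability tending to one as $n\to\infty$. Moreover, writing $\dot A=\dot A(\theta^0)$, $M=M(\theta^0)$, $C=C(\theta^0)$, the matrix $\dot A^\top M\dot A$ is invertible, the matrix $$\Psi=(\dot A^\top M\dot A)^{-1}\,\dot A^\top M\,C\,M\,\dot A\,(\dot A^\top M\dot A)^{-1}$$ is positive semidefinite, and $$\sqrt n\,\bigl(\hat\theta^{(n)}-\theta^0\bigr)\xrightarrow{D}N(0,\Psi).$$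 -/

import Mathlib

open MeasureTheory ProbabilityTheory Filter
open scoped Topology Matrix

noncomputable section

namespace MinChiSquare

/-- The `d × k` Jacobian matrix of `A : ℝᵏ → ℝᵈ` at `θ`: its `(i, j)` entry is the `i`-th coordinate
of the partial derivative of `A` at `θ` in the `j`-th coordinate direction. -/
def jacobian {k d : ℕ} (A : EuclideanSpace ℝ (Fin k) → EuclideanSpace ℝ (Fin d))
    (θ : EuclideanSpace ℝ (Fin k)) : Matrix (Fin d) (Fin k) ℝ :=
  Matrix.of fun i j => (lineDeriv ℝ A θ (EuclideanSpace.single j 1)) i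

/-- The standing assumptions on the model `A` and the middle matrix `M` over the parameter space
`Θ ⊆ ℝᵏ`, with true parameter `θ₀`. Only the values of `A` and `M` on `Θ` are constrained. -/
structure StandardAssumptions {k d : ℕ} (Θ : Set (EuclideanSpace ℝ (Fin k)))
    (A : EuclideanSpace ℝ (Fin k) → EuclideanSpace ℝ (Fin d))
    (M : EuclideanSpace ℝ (Fin k) → Matrix (Fin d) (Fin d) ℝ)
    (θ₀ : EuclideanSpace ℝ (Fin k)) : Prop where
  /-- `A` is bicontinuous: `θⱼ → θ` if and only if `A θⱼ → A θ`. -/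
  bicontinuous : ∀ θ ∈ Θ, ∀ t : ℕ → EuclideanSpace ℝ (Fin k), (∀ j, t j ∈ Θ) →
    (Tendsto t atTop (𝓝 θ) ↔ Tendsto (fun j => A (t j)) atTop (𝓝 (A θ)))
  /-- `A` has first partial derivatives on `Θ`. -/
  partial_exists : ∀ θ ∈ Θ, ∀ j : Fin k,
    LineDifferentiableAt ℝ A θ (EuclideanSpace.single j 1)
  /-- The first partial derivatives of `A` are continuous on `Θ`. -/
  partial_continuous : ContinuousOn (jacobian A) Θ
  /-- The Jacobian of `A` has full rank `k` on `Θ`. -/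
  full_rank : ∀ θ ∈ Θ, (jacobian A θ).rank = k
  /-- `M θ` is symmetric and positive semidefinite. -/
  posSemidef : ∀ θ ∈ Θ, (M θ).PosSemidef
  /-- `M` is continuous on `Θ`. -/
  continuous_middle : ContinuousOn M Θ
  /-- For some `η > 0`, `M θ - η I` is positive definite in a neighbourhood of `θ₀`. -/
  posDef_near : ∃ η : ℝ, 0 < η ∧
    ∀ᶠ θ in 𝓝 θ₀, (M θ - η • (1 : Matrix (Fin d) (Fin d) ℝ)).PosDef

/-- The quadratic form `n (v - A θ)ᵀ W (v - A θ)`, as a function of the data vector `v`, the middle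
matrix `W` and the parameter `θ`. -/
def quadChi {k d : ℕ} (n : ℕ) (A : EuclideanSpace ℝ (Fin k) → EuclideanSpace ℝ (Fin d))
    (v : EuclideanSpace ℝ (Fin d)) (W : Matrix (Fin d) (Fin d) ℝ)
    (θ : EuclideanSpace ℝ (Fin k)) : ℝ :=
  n * ((v - A θ).ofLp ⬝ᵥ (W *ᵥ (v - A θ).ofLp))

/-- `R̂⁽ⁿ⁾(θ) = n (v - A θ)ᵀ M(φ v) (v - A θ)`: the quadratic form in which the middle matrix is
evaluated at the rough estimate `φ v` of the parameter. -/
def estQuadChi {k d : ℕ} (n : ℕ) (A : EuclideanSpace ℝ (Fin k) → EuclideanSpace ℝ (Fin d))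
    (M : EuclideanSpace ℝ (Fin k) → Matrix (Fin d) (Fin d) ℝ)
    (φ : EuclideanSpace ℝ (Fin d) → EuclideanSpace ℝ (Fin k))
    (v : EuclideanSpace ℝ (Fin d)) (θ : EuclideanSpace ℝ (Fin k)) : ℝ :=
  quadChi n A v (M (φ v)) θ

/-- `θ` is a minimizer of `f` over `Θ`. -/
def IsMinimizer {k : ℕ} (Θ : Set (EuclideanSpace ℝ (Fin k))) (f : EuclideanSpace ℝ (Fin k) → ℝ)
    (θ : EuclideanSpace ℝ (Fin k)) : Prop :=
  θ ∈ Θ ∧ IsMinOn f Θ θ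

/-- The sandwich covariance `(Jᵀ M J)⁻¹ Jᵀ M C M J (Jᵀ M J)⁻¹`. -/
def sandwich {k d : ℕ} (J : Matrix (Fin d) (Fin k) ℝ) (M C : Matrix (Fin d) (Fin d) ℝ) :
    Matrix (Fin k) (Fin k) ℝ :=
  (Jᵀ * M * J)⁻¹ * (Jᵀ * M * C * M * J) * (Jᵀ * M * J)⁻¹

end MinChiSquare

end

/-! The probabilistic content is a delta method for the map from data to minimizer; the work is a
deterministic estimate, uniform over all minimizers. Let the data `v` be near `A θ₀` and the rough
estimate `t` near `θ₀`. Coercivity of the weights forces any `θ` doing at least as well as `θ₀` to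
satisfy `‖v - A θ‖ = O(‖v - A θ₀‖)`, so `A θ → A θ₀`, and bicontinuity gives `θ → θ₀`
(`LocalModel.tendsto_param`). Compactness of a small ball then yields a minimizer. At a minimizer,
`A'(θ)ᵀ T(t) (v - A θ) = 0`. Freezing the coefficients at `θ₀`, linearizing `A` and applying
`(JᵀMJ)⁻¹` gives `θ - θ₀ = L (v - A θ₀) + o(‖v - A θ₀‖)` with `L = (JᵀMJ)⁻¹JᵀM`
(`LocalModel.eventually_norm_minimizer_sub_le`). Since `√n (V n - A θ₀)` is bounded in probability,
the scaled remainder vanishes in probability. Slutsky's theorem leaves the image under `L` of the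
Gaussian limit, whose covariance `L C Lᵀ` is the sandwich. -/

namespace MinChiSquare

/-! ### Differentiability from continuous partial derivatives -/

section Calculus

open Asymptotics

variable {ι G : Type*} [Fintype ι] [DecidableEq ι] [NormedAddCommGroup G] [NormedSpace ℝ G]

/-- A one-dimensional increment of `f` is close to linear if the directional derivative is. -/
lemma norm_lineDeriv_increment_le {E : Type*} [NormedAddCommGroup E] [NormedSpace ℝ E]
    {f g : E → G} {y e : E} {c : G} {ε s : ℝ}
    (hd : ∀ t ∈ Set.uIcc 0 s, HasLineDerivAt ℝ f (g (y + t • e)) (y + t • e) e)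
    (hb : ∀ t ∈ Set.uIcc 0 s, ‖g (y + t • e) - c‖ ≤ ε) :
    ‖f (y + s • e) - f y - s • c‖ ≤ ε * |s| := by
  have key : ∀ t ∈ Set.uIcc 0 s, HasDerivWithinAt (fun t : ℝ => f (y + t • e) - t • c)
      (g (y + t • e) - c) (Set.uIcc 0 s) t := by
    intro t ht
    have h1 : HasDerivAt (fun r : ℝ => f (y + r • e)) (g (y + t • e)) t := by
      have h0 := hd t ht
      unfold HasLineDerivAt at h0
      have h2 := HasDerivAt.comp_sub_const t t (by rw [sub_self]; exact h0)
      refine h2.congr_of_eventuallyEq (Eventually.of_forall fun r => ?_)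
      simp only
      congr 1
      rw [add_assoc, ← add_smul]
      congr 2
      ring
    have h3 : HasDerivAt (fun r : ℝ => r • c) c t := by
      simpa using (hasDerivAt_id t).smul_const c
    exact (h1.sub h3).hasDerivWithinAt
  have := Convex.norm_image_sub_le_of_norm_hasDerivWithin_le key hb (convex_uIcc 0 s)
    Set.left_mem_uIcc Set.right_mem_uIcc
  simp only [zero_smul, add_zero, sub_zero, Real.norm_eq_abs] at this
  convert this using 2
  abel

/-- A function on a Euclidean space whose partial derivatives exist near `x` and are continuous at
`x` is differentiable at `x`. -/
theorem hasFDerivAt_of_continuousAt_partial {f : EuclideanSpace ℝ ι → G}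
    {f' : ι → EuclideanSpace ℝ ι → G} {x : EuclideanSpace ℝ ι}
    (hd : ∀ j, ∀ᶠ y in 𝓝 x, HasLineDerivAt ℝ f (f' j y) y (EuclideanSpace.single j 1))
    (hc : ∀ j, ContinuousAt (f' j) x) :
    HasFDerivAt f (∑ j, (EuclideanSpace.proj j : EuclideanSpace ℝ ι →L[ℝ] ℝ).smulRight (f' j x))
      x := by
  -- `S s h` keeps the coordinates of `h` in `s` and kills the others; the induction on `s` switches
  -- on one coordinate at a time, each costing one mean value estimate.
  set S : Finset ι → EuclideanSpace ℝ ι →L[ℝ] EuclideanSpace ℝ ι := fun s =>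
    ∑ j ∈ s, (EuclideanSpace.proj j : EuclideanSpace ℝ ι →L[ℝ] ℝ).smulRight
      (EuclideanSpace.single j (1 : ℝ)) with hS
  have key : ∀ s : Finset ι, (fun h => f (x + S s h) - f x - ∑ j ∈ s, h j • f' j x)
      =o[𝓝 0] (fun h : EuclideanSpace ℝ ι => h) := by
    intro s
    induction s using Finset.induction_on with
    | empty => simp [hS]
    | insert a s ha ih =>
      have step : (fun h : EuclideanSpace ℝ ι => f (x + S s h + h a • EuclideanSpace.single a (1:ℝ))
          - f (x + S s h) - h a • f' a x) =o[𝓝 0] (fun h : EuclideanSpace ℝ ι => h) := by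
        rw [isLittleO_iff]
        intro ε hε
        have hev : ∀ᶠ y in 𝓝 x, HasLineDerivAt ℝ f (f' a y) y (EuclideanSpace.single a 1) ∧
            ‖f' a y - f' a x‖ ≤ ε := by
          refine (hd a).and ?_
          filter_upwards [(hc a).eventually (Metric.ball_mem_nhds (f' a x) hε)] with y hy
          exact (mem_ball_iff_norm.1 hy).le
        obtain ⟨δ, hδ, hball⟩ := Metric.eventually_nhds_iff.1 hev
        have h1 : Tendsto (fun h : EuclideanSpace ℝ ι => ‖S s h‖ + ‖h‖) (𝓝 0) (𝓝 0) := by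
          have : Continuous (fun h : EuclideanSpace ℝ ι => ‖S s h‖ + ‖h‖) := by fun_prop
          simpa using this.tendsto 0
        filter_upwards [h1.eventually (gt_mem_nhds hδ)] with h hh
        have hin : ∀ t ∈ Set.uIcc 0 (h a),
            dist (x + S s h + t • EuclideanSpace.single a (1:ℝ)) x < δ := by
          intro t ht
          have ht' : |t| ≤ ‖h‖ := by
            have h2 := Set.abs_sub_left_of_mem_uIcc ht
            simp only [sub_zero] at h2
            exact h2.trans (PiLp.norm_apply_le h a)
          rw [dist_eq_norm]
          calc ‖x + S s h + t • EuclideanSpace.single a (1:ℝ) - x‖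
              = ‖S s h + t • EuclideanSpace.single a (1:ℝ)‖ := by congr 1; abel
            _ ≤ ‖S s h‖ + |t| := by
              refine (norm_add_le _ _).trans ?_
              simp [norm_smul]
            _ < δ := by linarith
        refine (norm_lineDeriv_increment_le (g := f' a) (ε := ε) (fun t ht => (hball (hin t ht)).1)
          (fun t ht => (hball (hin t ht)).2)).trans ?_
        gcongr
        exact PiLp.norm_apply_le h a
      refine (ih.add step).congr_left fun h => ?_
      rw [Finset.sum_insert ha]
      have : x + S (insert a s) h = x + S s h + h a • EuclideanSpace.single a (1:ℝ) := by
        simp only [hS, Finset.sum_insert ha]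
        simp [add_comm, add_left_comm]
      rw [this]
      abel
  have huniv : ∀ h : EuclideanSpace ℝ ι, S Finset.univ h = h := by
    intro h
    ext i
    simp [hS, Finset.sum_apply, Pi.single_apply]
  rw [hasFDerivAt_iff_isLittleO_nhds_zero]
  refine (key Finset.univ).congr_left fun h => ?_
  rw [huniv]
  simp

end Calculus

/-! ### The filter of competitors to the true parameter -/

section SublevelFilter

open scoped RealInnerProductSpace

variable {E F : Type*} [TopologicalSpace E] [NormedAddCommGroup F] [InnerProductSpace ℝ F]

/-- The quadratic distance `⟨v - A θ, W (v - A θ)⟩` from the data `v` to the model `A θ`. -/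
def quadDist {X : Type*} (A : X → F) (v : F) (W : F →L[ℝ] F) (θ : X) : ℝ := ⟪v - A θ, W (v - A θ)⟫

variable {Θ : Set E} {A : E → F} {T : E → F →L[ℝ] F} {θ₀ : E}

/-- The filter of triples `(data, rough estimate, parameter)` in which the data tend to `A θ₀`, the
rough estimate to `θ₀`, and the parameter does at least as well as `θ₀`. -/
def sublevelFilter (Θ : Set E) (A : E → F) (T : E → F →L[ℝ] F) (θ₀ : E) :
    Filter ((F × E) × E) :=
  comap Prod.fst (𝓝 (A θ₀, θ₀)) ⊓
    𝓟 {p | p.2 ∈ Θ ∧ quadDist A p.1.1 (T p.1.2) p.2 ≤ quadDist A p.1.1 (T p.1.2) θ₀}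

/-- Only data and rough estimate are localized, while `θ` ranges over the whole sublevel set. Landau
relations along this filter are therefore uniform in `θ`. -/
lemma eventually_sublevelFilter {p : (F × E) × E → Prop} :
    (∀ᶠ x in sublevelFilter Θ A T θ₀, p x) ↔ ∀ᶠ y in 𝓝 (A θ₀, θ₀), ∀ θ ∈ Θ,
      quadDist A y.1 (T y.2) θ ≤ quadDist A y.1 (T y.2) θ₀ → p (y, θ) := by
  rw [sublevelFilter, eventually_inf_principal, eventually_comap]
  constructor
  · intro h
    filter_upwards [h] with y hy θ hθ hle
    exact hy (y, θ) rfl ⟨hθ, hle⟩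
  · intro h
    filter_upwards [h] with y hy
    rintro ⟨y', θ⟩ rfl ⟨hθ, hle⟩
    exact hy θ hθ hle

lemma tendsto_data : Tendsto (fun p : (F × E) × E => p.1.1) (sublevelFilter Θ A T θ₀)
    (𝓝 (A θ₀)) :=
  (continuous_fst.tendsto' (A θ₀, θ₀) (A θ₀) rfl).comp (tendsto_comap.mono_left inf_le_left)

lemma tendsto_rough : Tendsto (fun p : (F × E) × E => p.1.2) (sublevelFilter Θ A T θ₀)
    (𝓝 θ₀) :=
  (continuous_snd.tendsto' (A θ₀, θ₀) θ₀ rfl).comp (tendsto_comap.mono_left inf_le_left)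

end SublevelFilter

/-! ### Existence and first-order expansion of minimizers -/

section Deterministic

open Asymptotics
open scoped RealInnerProductSpace InnerProduct

variable {E F : Type*} [NormedAddCommGroup E] [InnerProductSpace ℝ E]
  [NormedAddCommGroup F] [InnerProductSpace ℝ F]

/-- Coercivity bounds the form at `θ` from below and the operator norm bounds it at `θ₀` from above;
`κ²` dominates the ratio of the two constants. -/
lemma norm_sub_le_of_quadDist_le {X : Type*} {A : X → F} {v : F} {W : F →L[ℝ] F} {η κ : ℝ}
    (hη : 0 < η) (hκ : 0 ≤ κ) (hW : ∀ u, η * ‖u‖ ^ 2 ≤ ⟪u, W u⟫) (hWκ : ‖W‖ ≤ κ ^ 2 * η) {θ θ₀ : X}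
    (h : quadDist A v W θ ≤ quadDist A v W θ₀) : ‖v - A θ‖ ≤ κ * ‖v - A θ₀‖ := by
  have h1 := hW (v - A θ)
  have h2 : ⟪v - A θ₀, W (v - A θ₀)⟫ ≤ (κ ^ 2 * η) * ‖v - A θ₀‖ ^ 2 :=
    calc ⟪v - A θ₀, W (v - A θ₀)⟫ ≤ ‖v - A θ₀‖ * ‖W (v - A θ₀)‖ := real_inner_le_norm _ _
      _ ≤ ‖v - A θ₀‖ * (‖W‖ * ‖v - A θ₀‖) := by gcongr; exact W.le_opNorm _
      _ ≤ ‖v - A θ₀‖ * ((κ ^ 2 * η) * ‖v - A θ₀‖) := by gcongr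
      _ = _ := by ring
  unfold quadDist at h
  have h3 : η * ‖v - A θ‖ ^ 2 ≤ η * (κ * ‖v - A θ₀‖) ^ 2 := by
    calc _ ≤ _ := h1.trans (h.trans h2)
      _ = _ := by ring
  exact (sq_le_sq₀ (norm_nonneg _) (by positivity)).1 (le_of_mul_le_mul_left h3 hη)

lemma tendsto_clm_comp {X : Type*} {l : Filter X} {f : X → F →L[ℝ] E} {g : X → F →L[ℝ] F}
    {f₀ : F →L[ℝ] E} {g₀ : F →L[ℝ] F} (hf : Tendsto f l (𝓝 f₀)) (hg : Tendsto g l (𝓝 g₀)) :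
    Tendsto (fun x => f x ∘L g x) l (𝓝 (f₀ ∘L g₀)) := by
  have hcomp : Continuous (fun q : (F →L[ℝ] E) × (F →L[ℝ] F) => q.1 ∘L q.2) :=
    continuous_fst.clm_comp continuous_snd
  exact (hcomp.tendsto (f₀, g₀)).comp (hf.prodMk_nhds hg)

/-- First-order condition at an interior minimizer of a quadratic distance. -/
lemma adjoint_apply_eq_zero_of_isLocalMin [CompleteSpace E] [CompleteSpace F] {A : E → F}
    {A' : E →L[ℝ] F} {v : F} {W : F →L[ℝ] F}
    (hW : ∀ x y, ⟪W x, y⟫ = ⟪x, W y⟫) {θ : E} (hA : HasFDerivAt A A' θ)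
    (hmin : IsLocalMin (quadDist A v W) θ) : A'.adjoint (W (v - A θ)) = 0 := by
  have hu : HasFDerivAt (fun θ => v - A θ) (-A') θ := hA.const_sub v
  have hq := hu.inner ℝ (W.hasFDerivAt.comp θ hu)
  have h0 := hmin.hasFDerivAt_eq_zero hq
  refine ext_inner_left ℝ fun h => ?_
  have h1 := congrArg (fun T : E →L[ℝ] ℝ => T h) h0
  simp [fderivInnerCLM_apply] at h1
  rw [ContinuousLinearMap.adjoint_inner_right, inner_zero_right]
  have h2 : ⟪v - A θ, W (A' h)⟫ = ⟪A' h, W (v - A θ)⟫ := by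
    rw [← hW, real_inner_comm]
  rw [← map_sub] at h1
  linarith

/-- A minimum-distance problem near the point `θ₀`: a model `A` with derivative `A'` and inverse
continuous at `A θ₀`, and weights `T` that are symmetric and coercive near `θ₀`. -/
structure LocalModel (Θ : Set E) (A : E → F) (A' : E → E →L[ℝ] F) (T : E → F →L[ℝ] F) (θ₀ : E)
    (η : ℝ) : Prop where
  isOpen : IsOpen Θ
  mem : θ₀ ∈ Θ
  tendsto_inverse : Tendsto id (comap A (𝓝 (A θ₀)) ⊓ 𝓟 Θ) (𝓝 θ₀)
  hasFDerivAt : ∀ θ ∈ Θ, HasFDerivAt A (A' θ) θ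
  continuousAt_deriv : ContinuousAt A' θ₀
  continuousAt_weight : ContinuousAt T θ₀
  pos : 0 < η
  symm : ∀ᶠ t in 𝓝 θ₀, ∀ x y, ⟪T t x, y⟫ = ⟪x, T t y⟫
  coercive : ∀ᶠ t in 𝓝 θ₀, ∀ u, η * ‖u‖ ^ 2 ≤ ⟪u, T t u⟫

namespace LocalModel

variable {Θ : Set E} {A : E → F} {A' : E → E →L[ℝ] F} {T : E → F →L[ℝ] F} {θ₀ : E} {η : ℝ}

lemma exists_bound (h : LocalModel Θ A A' T θ₀ η) : ∃ κ : ℝ, ∀ᶠ t in 𝓝 θ₀,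
    ∀ v θ, quadDist A v (T t) θ ≤ quadDist A v (T t) θ₀ → ‖v - A θ‖ ≤ κ * ‖v - A θ₀‖ := by
  have hη := h.pos
  refine ⟨√((‖T θ₀‖ + 1) / η), ?_⟩
  have hn : ∀ᶠ t in 𝓝 θ₀, ‖T t‖ < ‖T θ₀‖ + 1 :=
    h.continuousAt_weight.norm.eventually (gt_mem_nhds (lt_add_one _))
  filter_upwards [hn, h.coercive] with t ht hc v θ hle
  refine norm_sub_le_of_quadDist_le hη (Real.sqrt_nonneg _) hc ?_ hle
  rw [Real.sq_sqrt (by positivity), div_mul_cancel₀ _ hη.ne']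
  exact ht.le

lemma isBigO_residual (h : LocalModel Θ A A' T θ₀ η) :
    (fun p : (F × E) × E => p.1.1 - A p.2) =O[sublevelFilter Θ A T θ₀]
      (fun p => p.1.1 - A θ₀) := by
  obtain ⟨κ, hκ⟩ := h.exists_bound
  refine IsBigO.of_bound κ (eventually_sublevelFilter.2 ?_)
  filter_upwards [(continuous_snd.tendsto' (A θ₀, θ₀) θ₀ rfl).eventually hκ] with y hy θ _ hle
  exact hy y.1 θ hle

lemma isBigO_model (h : LocalModel Θ A A' T θ₀ η) :
    (fun p : (F × E) × E => A p.2 - A θ₀) =O[sublevelFilter Θ A T θ₀]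
      (fun p => p.1.1 - A θ₀) :=
  ((isBigO_refl _ _).sub h.isBigO_residual).congr_left fun p => by abel

/-- The model values converge by `isBigO_model`; continuity of the inverse of `A` at `A θ₀`
transfers this to the parameters. This excludes distant competitors. -/
lemma tendsto_param (h : LocalModel Θ A A' T θ₀ η) :
    Tendsto (fun p : (F × E) × E => p.2) (sublevelFilter Θ A T θ₀) (𝓝 θ₀) := by
  have h0 : Tendsto (fun p : (F × E) × E => p.1.1 - A θ₀) (sublevelFilter Θ A T θ₀) (𝓝 0) :=
    tendsto_sub_nhds_zero_iff.2 tendsto_data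
  have h1 : Tendsto (fun p : (F × E) × E => A p.2) (sublevelFilter Θ A T θ₀) (𝓝 (A θ₀)) :=
    tendsto_sub_nhds_zero_iff.1 (h.isBigO_model.trans_tendsto h0)
  refine h.tendsto_inverse.comp (tendsto_inf.2 ⟨tendsto_comap_iff.2 h1, tendsto_principal.2 ?_⟩)
  exact eventually_sublevelFilter.2 (Eventually.of_forall fun y θ hθ _ => hθ)

/-- If the data and the rough estimate are close to their limits, the quadratic distance has a
minimizer. -/
theorem eventually_exists_isMinOn [ProperSpace E] (h : LocalModel Θ A A' T θ₀ η) :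
    ∀ᶠ y in 𝓝 (A θ₀, θ₀), ∃ θ ∈ Θ, IsMinOn (quadDist A y.1 (T y.2)) Θ θ := by
  obtain ⟨ε, hε, hsub⟩ := Metric.nhds_basis_closedBall.mem_iff.1 (h.isOpen.mem_nhds h.mem)
  filter_upwards [eventually_sublevelFilter.1
    (h.tendsto_param.eventually (Metric.closedBall_mem_nhds θ₀ hε))] with y hy
  have hcont : ContinuousOn (quadDist A y.1 (T y.2)) (Metric.closedBall θ₀ ε) := by
    have hA : ContinuousOn A (Metric.closedBall θ₀ ε) := fun θ hθ =>
      (h.hasFDerivAt θ (hsub hθ)).continuousAt.continuousWithinAt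
    have hu : ContinuousOn (fun θ => y.1 - A θ) (Metric.closedBall θ₀ ε) :=
      continuousOn_const.sub hA
    exact hu.inner ((T y.2).continuous.comp_continuousOn hu)
  obtain ⟨θ, hθ, hmin⟩ := (isCompact_closedBall θ₀ ε).exists_isMinOn
    ⟨θ₀, Metric.mem_closedBall_self hε.le⟩ hcont
  refine ⟨θ, hsub hθ, fun θ' hθ' => ?_⟩
  -- Competitors at least as good as `θ₀` lie in the ball; the others lose to `θ₀`, which is in the
  -- ball.
  by_cases hle : quadDist A y.1 (T y.2) θ' ≤ quadDist A y.1 (T y.2) θ₀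
  · exact hmin (hy θ' hθ' hle)
  · exact (hmin (Metric.mem_closedBall_self hε.le)).trans (not_le.1 hle).le

/-- Minimizers of the quadratic distance depend on the data linearly up to first order. -/
theorem eventually_norm_minimizer_sub_le [CompleteSpace E] [CompleteSpace F]
    (h : LocalModel Θ A A' T θ₀ η) {L : F →L[ℝ] E}
    {G : E →L[ℝ] E} (hL : L = G ∘L (A' θ₀).adjoint ∘L T θ₀)
    (hLA : L ∘L A' θ₀ = ContinuousLinearMap.id ℝ E) {ε : ℝ} (hε : 0 < ε) :
    ∀ᶠ y in 𝓝 (A θ₀, θ₀), ∀ θ ∈ Θ, IsMinOn (quadDist A y.1 (T y.2)) Θ θ →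
      ‖θ - θ₀ - L (y.1 - A θ₀)‖ ≤ ε * ‖y.1 - A θ₀‖ := by
  set l := sublevelFilter Θ A T θ₀
  have hinv : ∀ x, L (A' θ₀ x) = x := fun x => by
    rw [← ContinuousLinearMap.comp_apply, hLA, ContinuousLinearMap.id_apply]
  have hlin : (fun p : (F × E) × E => A p.2 - A θ₀ - A' θ₀ (p.2 - θ₀)) =o[l]
      (fun p => p.1.1 - A θ₀) := by
    have h1 : (fun p : (F × E) × E => A p.2 - A θ₀ - A' θ₀ (p.2 - θ₀)) =o[l]
        (fun p => p.2 - θ₀) :=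
      (h.hasFDerivAt θ₀ h.mem).isLittleO.comp_tendsto h.tendsto_param
    -- Applying the left inverse `L` to `h1` gives `θ - θ₀ = L (A θ - A θ₀) + o(θ - θ₀)`, and the
    -- last term is absorbed on the left.
    have h2 : (fun p : (F × E) × E => p.2 - θ₀) =O[l] (fun p => A p.2 - A θ₀) := by
      refine IsBigO.trans (IsLittleO.right_isBigO_sub
        ((L.isBigO_comp _ l).trans_isLittleO h1.neg_left)) ?_
      refine (L.isBigO_comp (fun p : (F × E) × E => A p.2 - A θ₀) l).congr_left fun p => ?_
      rw [map_neg, map_sub L (A p.2 - A θ₀), hinv]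
      abel
    exact h1.trans_isBigO (h2.trans h.isBigO_model)
  have hop : Tendsto (fun p : (F × E) × E => (A' p.2).adjoint ∘L T p.1.2 -
      (A' θ₀).adjoint ∘L T θ₀) l (𝓝 0) := by
    refine tendsto_sub_nhds_zero_iff.2 ?_
    have ha : Tendsto (fun p : (F × E) × E => (A' p.2).adjoint) l (𝓝 (A' θ₀).adjoint) :=
      ((ContinuousLinearMap.adjoint (𝕜 := ℝ) (E := E) (F := F)).continuous.tendsto _).comp
        (h.continuousAt_deriv.tendsto.comp h.tendsto_param)
    exact tendsto_clm_comp ha (h.continuousAt_weight.tendsto.comp tendsto_rough)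
  have hrem : (fun p : (F × E) × E => ((A' p.2).adjoint ∘L T p.1.2 -
      (A' θ₀).adjoint ∘L T θ₀) (p.1.1 - A p.2)) =o[l] (fun p => p.1.1 - A θ₀) := by
    refine IsLittleO.trans_isBigO ?_ h.isBigO_residual
    rw [isLittleO_iff]
    intro c hc
    filter_upwards [hop.norm.eventually (gt_mem_nhds (by simpa using hc))] with p hp
    exact (ContinuousLinearMap.le_opNorm _ _).trans (by gcongr)
  -- At a minimizer this combination of remainders is exactly `θ - θ₀ - L (v - A θ₀)`, by the
  -- first-order condition (`e5` below).
  have hsum := ((G.isBigO_comp _ l).trans_isLittleO hrem).sub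
    ((L.isBigO_comp _ l).trans_isLittleO hlin)
  have hfin := eventually_sublevelFilter.1 (hsum.def hε)
  have hsymm : ∀ᶠ y : F × E in 𝓝 (A θ₀, θ₀), ∀ u w, ⟪T y.2 u, w⟫ = ⟪u, T y.2 w⟫ :=
    (continuous_snd.tendsto' (A θ₀, θ₀) θ₀ rfl).eventually h.symm
  filter_upwards [hfin, hsymm] with y hy hs θ hθ hmin
  have hle := hy θ hθ (hmin h.mem)
  have hz := adjoint_apply_eq_zero_of_isLocalMin hs (h.hasFDerivAt θ hθ)
    (hmin.isLocalMin (h.isOpen.mem_nhds hθ))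
  have e2 : G ((A' θ₀).adjoint (T θ₀ (y.1 - A θ))) = L (y.1 - A θ) := by rw [hL]; rfl
  have e3 : ((A' θ).adjoint ∘L T y.2 - (A' θ₀).adjoint ∘L T θ₀) (y.1 - A θ) =
      -(A' θ₀).adjoint (T θ₀ (y.1 - A θ)) := by
    rw [sub_apply, ContinuousLinearMap.comp_apply, ContinuousLinearMap.comp_apply, hz, zero_sub]
  have e4 : L (y.1 - A θ₀) = L (y.1 - A θ) + L (A θ - A θ₀) := by rw [← map_add]; congr 1; abel
  have e5 : G (((A' θ).adjoint ∘L T y.2 - (A' θ₀).adjoint ∘L T θ₀) (y.1 - A θ)) -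
      L (A θ - A θ₀ - A' θ₀ (θ - θ₀)) = θ - θ₀ - L (y.1 - A θ₀) := by
    rw [e3, map_neg, e2, map_sub L (A θ - A θ₀), hinv, e4]
    abel
  exact e5 ▸ hle

end LocalModel

end Deterministic

/-! ### Matrices as operators, and Gaussian images -/

section Matrices

open scoped RealInnerProductSpace

variable {l m n : Type*} [Fintype l] [Fintype m] [Fintype n] [DecidableEq n]

/-- The continuous linear map between Euclidean spaces given by a rectangular matrix. -/
noncomputable def matrixCLM :
    Matrix m n ℝ →ₗ[ℝ] (EuclideanSpace ℝ n →L[ℝ] EuclideanSpace ℝ m) :=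
  (Matrix.toEuclideanLin.trans LinearMap.toContinuousLinearMap).toLinearMap

lemma ofLp_matrixCLM (B : Matrix m n ℝ) (x : EuclideanSpace ℝ n) :
    (matrixCLM B x).ofLp = B *ᵥ x.ofLp := rfl

lemma continuous_matrixCLM :
    Continuous (matrixCLM : Matrix m n ℝ →ₗ[ℝ] (EuclideanSpace ℝ n →L[ℝ] EuclideanSpace ℝ m)) :=
  LinearMap.continuous_of_finiteDimensional _

lemma matrixCLM_mul [DecidableEq m] (B : Matrix l m ℝ) (D : Matrix m n ℝ) :
    matrixCLM (B * D) = matrixCLM B ∘L matrixCLM D := by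
  ext x i
  simp [ofLp_matrixCLM]

lemma matrixCLM_one : matrixCLM (1 : Matrix n n ℝ) = ContinuousLinearMap.id ℝ _ := by
  ext x i
  simp [ofLp_matrixCLM]

lemma inner_matrixCLM (B : Matrix m n ℝ) (x : EuclideanSpace ℝ m) (y : EuclideanSpace ℝ n) :
    ⟪x, matrixCLM B y⟫ = x.ofLp ⬝ᵥ B *ᵥ y.ofLp := by
  rw [EuclideanSpace.inner_eq_star_dotProduct, ofLp_matrixCLM, star_trivial]
  exact dotProduct_comm _ _

lemma adjoint_matrixCLM [DecidableEq m] (B : Matrix m n ℝ) :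
    (matrixCLM B).adjoint = matrixCLM Bᵀ := by
  symm
  rw [ContinuousLinearMap.eq_adjoint_iff]
  intro x y
  rw [inner_matrixCLM, real_inner_comm, inner_matrixCLM, Matrix.dotProduct_mulVec,
    Matrix.vecMul_transpose]
  exact dotProduct_comm _ _

lemma mulVec_injective_of_rank_eq_card {ι κ : Type*} [Fintype κ] (B : Matrix ι κ ℝ)
    (h : B.rank = Fintype.card κ) :
    Function.Injective B.mulVec := by
  have h1 := LinearMap.finrank_range_add_finrank_ker B.mulVecLin
  rw [Matrix.rank] at h
  rw [h, Module.finrank_fintype_fun_eq_card] at h1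
  have h2 : Module.finrank ℝ (LinearMap.ker B.mulVecLin) = 0 := by omega
  exact LinearMap.ker_eq_bot.1 (Submodule.finrank_eq_zero.1 h2)

lemma posDef_of_posDef_sub_smul_one {ι : Type*} [DecidableEq ι] {B : Matrix ι ι ℝ} {η : ℝ}
    (hη : 0 < η) (h : (B - η • (1 : Matrix ι ι ℝ)).PosDef) : B.PosDef := by
  have := h.add (Matrix.PosDef.one.smul hη)
  rwa [sub_add_cancel] at this

lemma mul_norm_sq_le_inner_matrixCLM {B : Matrix n n ℝ} {η : ℝ}
    (h : (B - η • (1 : Matrix n n ℝ)).PosSemidef) (u : EuclideanSpace ℝ n) :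
    η * ‖u‖ ^ 2 ≤ ⟪u, matrixCLM B u⟫ := by
  have h1 := h.dotProduct_mulVec_nonneg u.ofLp
  rw [star_trivial, ← inner_matrixCLM, map_sub, map_smul, matrixCLM_one, sub_apply, inner_sub_right,
    smul_apply, real_inner_smul_right, ContinuousLinearMap.id_apply,
    real_inner_self_eq_norm_sq] at h1
  linarith

lemma inner_matrixCLM_comm {B : Matrix n n ℝ} (h : B.IsHermitian) (x y : EuclideanSpace ℝ n) :
    ⟪matrixCLM B x, y⟫ = ⟪x, matrixCLM B y⟫ := by
  rw [← ContinuousLinearMap.adjoint_inner_right, adjoint_matrixCLM,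
    ← Matrix.conjTranspose_eq_transpose_of_trivial, h.eq]

/-- The image of a centred Gaussian vector under a matrix. -/
theorem map_matrixCLM_multivariateGaussian [DecidableEq m] {S : Matrix n n ℝ} (hS : S.PosSemidef)
    (B : Matrix m n ℝ) :
    (multivariateGaussian 0 S).map (matrixCLM B) =
      multivariateGaussian 0 (B * S * Bᵀ) := by
  have hBS : (B * S * Bᵀ).PosSemidef := by
    simpa using hS.mul_mul_conjTranspose_same B
  -- A Gaussian law is determined by its mean and covariance.
  apply IsGaussian.ext
  · simp only [id_eq, integral_id_multivariateGaussian]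
    rw [ContinuousLinearMap.integral_id_map, integral_id_multivariateGaussian, map_zero]
    exact IsGaussian.integrable_id
  · ext x y
    rw [covarianceBilin_map IsGaussian.memLp_two_id, covarianceBilin_multivariateGaussian hS,
      covarianceBilin_multivariateGaussian hBS, adjoint_matrixCLM, ofLp_matrixCLM, ofLp_matrixCLM,
      ← Matrix.mulVec_mulVec, ← Matrix.mulVec_mulVec, Matrix.mulVec_transpose,
      ← Matrix.dotProduct_mulVec]

end Matrices

/-! ### Boundedness and smallness in probability -/

section Probability

open scoped ENNReal

variable {Ω Ω' E : Type*} [MeasurableSpace Ω] [MeasurableSpace Ω'] {P : Measure Ω}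
  [IsProbabilityMeasure P] {μ : Measure Ω'} [IsProbabilityMeasure μ]
  [NormedAddCommGroup E] [MeasurableSpace E] [BorelSpace E]

/-- A sequence that converges in distribution is bounded in probability. -/
theorem exists_eventually_measure_norm_ge_le {X : ℕ → Ω → E} {Z : Ω' → E}
    (h : TendstoInDistribution X atTop Z (fun _ => P) μ) {δ : ℝ≥0∞} (hδ : 0 < δ) :
    ∃ R : ℝ, 0 < R ∧ ∀ᶠ n in atTop, P {ω | R ≤ ‖X n ω‖} ≤ δ := by
  have hZ := h.aemeasurable_limit
  have := Measure.isProbabilityMeasure_map hZ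
  have htail : Tendsto (fun N : ℕ => μ.map Z {x | (N : ℝ) ≤ ‖x‖}) atTop (𝓝 0) := by
    have hempty : ⋂ N : ℕ, {x : E | (N : ℝ) ≤ ‖x‖} = ∅ := by
      ext x
      obtain ⟨N, hN⟩ := exists_nat_gt ‖x‖
      simpa using ⟨N, hN⟩
    rw [← measure_empty (μ := μ.map Z), ← hempty]
    refine tendsto_measure_iInter_atTop
      (fun N => (measurableSet_le measurable_const measurable_norm).nullMeasurableSet)
      (fun a b hab x (hx : (b : ℝ) ≤ ‖x‖) => (Nat.cast_le.2 hab).trans hx) ⟨0, measure_ne_top _ _⟩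
  obtain ⟨N, hN, hN0⟩ := ((htail.eventually (gt_mem_nhds hδ)).and (eventually_gt_atTop 0)).exists
  refine ⟨N, Nat.cast_pos.2 hN0, ?_⟩
  have hclosed : IsClosed {x : E | (N : ℝ) ≤ ‖x‖} := isClosed_le continuous_const continuous_norm
  -- Portmanteau for a closed set carries the tail bound of the limit over to the sequence.
  have hlim := ProbabilityMeasure.limsup_measure_closed_le_of_tendsto h.tendsto hclosed
  filter_upwards [eventually_lt_of_limsup_lt (hlim.trans_lt hN)] with n hn
  refine le_trans (le_of_eq ?_) hn.le
  exact (Measure.map_apply_of_aemeasurable (h.forall_aemeasurable n)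
    hclosed.measurableSet).symm

/-- If `√n (V n - a)` converges in distribution then `V n` tends to `a` in probability. -/
theorem tendsto_measure_compl_nhds_of_sqrt_smul [NormedSpace ℝ E] {V : ℕ → Ω → E} {a : E}
    {Z : Ω' → E}
    (h : TendstoInDistribution (fun (n : ℕ) ω => √(n : ℝ) • (V n ω - a)) atTop Z (fun _ => P) μ)
    {ε : ℝ} (hε : 0 < ε) : Tendsto (fun n => P {ω | ε ≤ ‖V n ω - a‖}) atTop (𝓝 0) := by
  rw [ENNReal.tendsto_nhds_zero]
  intro δ hδ
  obtain ⟨R, -, hR⟩ := exists_eventually_measure_norm_ge_le h hδ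
  have hs : Tendsto (fun n : ℕ => √(n : ℝ) * ε) atTop atTop :=
    (Real.tendsto_sqrt_atTop.comp tendsto_natCast_atTop_atTop).atTop_mul_const hε
  filter_upwards [hR, hs.eventually_ge_atTop R] with n hn hRn
  refine (measure_mono fun ω hω => ?_).trans hn
  rw [Set.mem_ofPred_eq, norm_smul, Real.norm_of_nonneg (Real.sqrt_nonneg _)]
  exact hRn.trans (mul_le_mul_of_nonneg_left hω (Real.sqrt_nonneg _))

/-- A sequence that is eventually small compared with a sequence bounded in probability, on events
of probability tending to one, tends to zero in probability. -/
theorem tendstoInMeasure_zero_of_norm_le {F : Type*} [NormedAddCommGroup F] {X : ℕ → Ω → E}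
    {Y : ℕ → Ω → F} {Z : Ω' → E} (h : TendstoInDistribution X atTop Z (fun _ => P) μ)
    (hY : ∀ ε : ℝ, 0 < ε → Tendsto (fun n => P {ω | ¬ ‖Y n ω‖ ≤ ε * ‖X n ω‖}) atTop (𝓝 0)) :
    TendstoInMeasure P Y atTop 0 := by
  rw [tendstoInMeasure_iff_norm]
  intro a ha
  rw [ENNReal.tendsto_nhds_zero]
  intro δ hδ
  have hδ2 : 0 < δ / 2 := ENNReal.half_pos hδ.ne'
  obtain ⟨R, hR0, hR⟩ := exists_eventually_measure_norm_ge_le h hδ2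
  -- With this ratio, `‖X n‖ < R` and the relative bound together force `‖Y n‖ < a`.
  have hε : 0 < a / R := div_pos ha hR0
  filter_upwards [hR, ENNReal.tendsto_nhds_zero.1 (hY _ hε) _ hδ2] with n h1 h2
  calc P {ω | a ≤ ‖Y n ω - (0 : Ω → F) ω‖}
      ≤ P ({ω | R ≤ ‖X n ω‖} ∪ {ω | ¬ ‖Y n ω‖ ≤ a / R * ‖X n ω‖}) := by
        refine measure_mono fun ω hω => ?_
        by_contra hcon
        simp only [Set.mem_union, Set.mem_ofPred_eq, not_or, not_le, not_lt] at hcon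
        simp only [Set.mem_ofPred_eq, Pi.zero_apply, sub_zero] at hω
        have h3 := hω.trans hcon.2
        have h4 : a / R * ‖X n ω‖ < a / R * R := mul_lt_mul_of_pos_left hcon.1 hε
        rw [div_mul_cancel₀ _ hR0.ne'] at h4
        linarith
    _ ≤ δ / 2 + δ / 2 := (measure_union_le _ _).trans (add_le_add h1 h2)
    _ = δ := ENNReal.add_halves δ

end Probability

/-! ### From the standing assumptions to the local model -/

variable {k d : ℕ} {Θ : Set (EuclideanSpace ℝ (Fin k))}
  {A : EuclideanSpace ℝ (Fin k) → EuclideanSpace ℝ (Fin d)}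
  {M : EuclideanSpace ℝ (Fin k) → Matrix (Fin d) (Fin d) ℝ} {θ₀ : EuclideanSpace ℝ (Fin k)}

lemma sum_proj_smulRight_lineDeriv (θ : EuclideanSpace ℝ (Fin k)) :
    ∑ j, (EuclideanSpace.proj j : EuclideanSpace ℝ (Fin k) →L[ℝ] ℝ).smulRight
      (lineDeriv ℝ A θ (EuclideanSpace.single j 1)) = matrixCLM (jacobian A θ) := by
  ext x i
  simp [ofLp_matrixCLM, jacobian, Matrix.mulVec, dotProduct, mul_comm]

lemma quadChi_eq_quadDist (n : ℕ) (v : EuclideanSpace ℝ (Fin d)) (W : Matrix (Fin d) (Fin d) ℝ)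
    (θ : EuclideanSpace ℝ (Fin k)) : quadChi n A v W θ = n * quadDist A v (matrixCLM W) θ := by
  rw [quadDist, inner_matrixCLM, quadChi]

/-- The positive factor `n` does not affect minimizers. At `n = 0` the form vanishes identically,
hence the restriction. -/
lemma isMinimizer_estQuadChi_iff {n : ℕ} (hn : 1 ≤ n)
    {φ : EuclideanSpace ℝ (Fin d) → EuclideanSpace ℝ (Fin k)} {v : EuclideanSpace ℝ (Fin d)}
    {θ : EuclideanSpace ℝ (Fin k)} : IsMinimizer Θ (estQuadChi n A M φ v) θ ↔
      θ ∈ Θ ∧ IsMinOn (quadDist A v (matrixCLM (M (φ v)))) Θ θ := by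
  have hn' : (0 : ℝ) < n := by exact_mod_cast hn
  unfold IsMinimizer
  simp only [isMinOn_iff, estQuadChi, quadChi_eq_quadDist, mul_le_mul_iff_right₀ hn']

namespace StandardAssumptions

lemma hasFDerivAt (h : StandardAssumptions Θ A M θ₀) (hΘ : IsOpen Θ)
    {θ : EuclideanSpace ℝ (Fin k)} (hθ : θ ∈ Θ) :
    HasFDerivAt A (matrixCLM (jacobian A θ)) θ := by
  rw [← sum_proj_smulRight_lineDeriv]
  refine hasFDerivAt_of_continuousAt_partial
    (f' := fun j θ => lineDeriv ℝ A θ (EuclideanSpace.single j 1)) (fun j => ?_) fun j => ?_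
  · filter_upwards [hΘ.mem_nhds hθ] with y hy
    exact (h.partial_exists y hy j).hasLineDerivAt
  · have hJ := h.partial_continuous.continuousAt (hΘ.mem_nhds hθ)
    have hcol : Continuous fun B : Matrix (Fin d) (Fin k) ℝ => WithLp.toLp 2 (fun i => B i j) := by
      fun_prop
    exact hcol.continuousAt.comp hJ

lemma tendsto_inverse (h : StandardAssumptions Θ A M θ₀) (hθ₀ : θ₀ ∈ Θ) :
    Tendsto id (comap A (𝓝 (A θ₀)) ⊓ 𝓟 Θ) (𝓝 θ₀) := by
  refine tendsto_of_seq_tendsto fun t ht => ?_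
  obtain ⟨h1, h2⟩ := tendsto_inf.1 ht
  -- The sequence is only eventually in `Θ`, whereas bicontinuity needs every term there, so the
  -- first `N` terms are dropped.
  obtain ⟨N, hN⟩ := eventually_atTop.1 (tendsto_principal.1 h2)
  have h3 : Tendsto (fun j => A (t (j + N))) atTop (𝓝 (A θ₀)) :=
    (tendsto_comap_iff.1 h1).comp (tendsto_add_atTop_nat N)
  exact (tendsto_add_atTop_iff_nat N).1
    ((h.bicontinuous θ₀ hθ₀ (fun j => t (j + N)) fun j => hN _ (Nat.le_add_left _ _)).2 h3)

lemma exists_localModel (h : StandardAssumptions Θ A M θ₀) (hΘ : IsOpen Θ) (hθ₀ : θ₀ ∈ Θ) :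
    ∃ η, LocalModel Θ A (fun θ => matrixCLM (jacobian A θ)) (fun t => matrixCLM (M t)) θ₀ η := by
  obtain ⟨η, hη, hpos⟩ := h.posDef_near
  have hnhds := hΘ.mem_nhds hθ₀
  refine ⟨η, hΘ, hθ₀, h.tendsto_inverse hθ₀, fun θ hθ => h.hasFDerivAt hΘ hθ,
    continuous_matrixCLM.continuousAt.comp (h.partial_continuous.continuousAt hnhds),
    continuous_matrixCLM.continuousAt.comp (h.continuous_middle.continuousAt hnhds), hη, ?_, ?_⟩
  · filter_upwards [hnhds] with t ht
    exact inner_matrixCLM_comm (h.posSemidef t ht).isHermitian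
  · filter_upwards [hpos] with t ht
    exact mul_norm_sq_le_inner_matrixCLM ht.posSemidef

/-- `M θ₀` is positive definite and full rank makes the Jacobian injective, so the product is
positive definite. -/
lemma isUnit_information (h : StandardAssumptions Θ A M θ₀) (hθ₀ : θ₀ ∈ Θ) :
    IsUnit ((jacobian A θ₀)ᵀ * M θ₀ * jacobian A θ₀) := by
  obtain ⟨η, hη, hpos⟩ := h.posDef_near
  have hM := posDef_of_posDef_sub_smul_one hη hpos.self_of_nhds
  have := hM.conjTranspose_mul_mul_same (mulVec_injective_of_rank_eq_card (jacobian A θ₀)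
    (by rw [h.full_rank θ₀ hθ₀, Fintype.card_fin]))
  rw [Matrix.conjTranspose_eq_transpose_of_trivial] at this
  exact this.isUnit

end StandardAssumptions

/-- In this form the sandwich is visibly the covariance of a linear image, which gives both its
positivity and the limit law. -/
lemma sandwich_eq_mul_mul_transpose {J : Matrix (Fin d) (Fin k) ℝ} {M C : Matrix (Fin d) (Fin d) ℝ}
    (hM : Mᵀ = M) : sandwich J M C = ((Jᵀ * M * J)⁻¹ * Jᵀ * M) * C *
      ((Jᵀ * M * J)⁻¹ * Jᵀ * M)ᵀ := by
  simp only [sandwich, Matrix.transpose_mul, Matrix.transpose_nonsing_inv,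
    Matrix.transpose_transpose, hM, Matrix.mul_assoc]

end MinChiSquare

open MinChiSquare in
theorem mainTheorem3 {k d : ℕ}
    (Θ : Set (EuclideanSpace ℝ (Fin k))) (hΘ : IsOpen Θ)
    (A : EuclideanSpace ℝ (Fin k) → EuclideanSpace ℝ (Fin d))
    (M C : EuclideanSpace ℝ (Fin k) → Matrix (Fin d) (Fin d) ℝ)
    (θ₀ : EuclideanSpace ℝ (Fin k)) (hθ₀ : θ₀ ∈ Θ)
    (hAM : MinChiSquare.StandardAssumptions Θ A M θ₀)
    (hC : ∀ θ ∈ Θ, (C θ).PosSemidef)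
    {Ω : Type*} [MeasurableSpace Ω] (P : Measure Ω) [IsProbabilityMeasure P]
    (V : ℕ → Ω → EuclideanSpace ℝ (Fin d))
    -- asymptotic normality: `√n (V⁽ⁿ⁾ - A(θ₀)) → N(0, C(θ₀))` in distribution
    (hV : TendstoInDistribution (fun (n : ℕ) ω => √(n : ℝ) • (V n ω - A θ₀)) atTop
      id (fun _ => P) (multivariateGaussian 0 (C θ₀)))
    -- consistent rough estimator
    (φ : ℕ → EuclideanSpace ℝ (Fin d) → EuclideanSpace ℝ (Fin k)) (hφm : ∀ n, Measurable (φ n))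
    (hφ : TendstoInMeasure P (fun n ω => φ n (V n ω)) atTop (fun _ => θ₀))
    -- the estimator: a random vector that minimizes `R̂⁽ⁿ⁾` over `Θ` whenever a minimizer exists
    (θhat : ℕ → Ω → EuclideanSpace ℝ (Fin k)) (hθm : ∀ n, AEMeasurable (θhat n) P)
    (hθhat : ∀ n, 1 ≤ n → ∀ᵐ ω ∂P,
      (∃ θ, MinChiSquare.IsMinimizer Θ (MinChiSquare.estQuadChi n A M (φ n) (V n ω)) θ) →
        MinChiSquare.IsMinimizer Θ (MinChiSquare.estQuadChi n A M (φ n) (V n ω)) (θhat n ω)) :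
    -- a minimizer exists with probability tending to one
    Tendsto (fun n : ℕ => P {ω | ¬ ∃ θ,
      MinChiSquare.IsMinimizer Θ (MinChiSquare.estQuadChi n A M (φ n) (V n ω)) θ}) atTop (𝓝 0) ∧
    -- the limiting covariance is well defined
    IsUnit ((MinChiSquare.jacobian A θ₀)ᵀ * M θ₀ * MinChiSquare.jacobian A θ₀) ∧
    (MinChiSquare.sandwich (MinChiSquare.jacobian A θ₀) (M θ₀) (C θ₀)).PosSemidef ∧
    -- `√n (θ̂⁽ⁿ⁾ - θ₀) → N(0, Ψ)` in distribution
    TendstoInDistribution (fun (n : ℕ) ω => √(n : ℝ) • (θhat n ω - θ₀)) atTop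
      id (fun _ => P) (multivariateGaussian 0
        (MinChiSquare.sandwich (MinChiSquare.jacobian A θ₀) (M θ₀) (C θ₀))) := by
  obtain ⟨η, hloc⟩ := hAM.exists_localModel hΘ hθ₀
  have hunit := hAM.isUnit_information hθ₀
  set J := jacobian A θ₀
  set B := (Jᵀ * M θ₀ * J)⁻¹ * Jᵀ * M θ₀ with hB
  have hMt : (M θ₀)ᵀ = M θ₀ := by
    rw [← Matrix.conjTranspose_eq_transpose_of_trivial]
    exact (hAM.posSemidef θ₀ hθ₀).isHermitian
  have hsand : sandwich J (M θ₀) (C θ₀) = B * C θ₀ * Bᵀ := sandwich_eq_mul_mul_transpose hMt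
  have hL : matrixCLM B = matrixCLM (Jᵀ * M θ₀ * J)⁻¹ ∘L (matrixCLM J).adjoint ∘L
      matrixCLM (M θ₀) := by
    rw [adjoint_matrixCLM, ← matrixCLM_mul, ← matrixCLM_mul, hB, Matrix.mul_assoc]
  have hLJ : matrixCLM B ∘L matrixCLM J = ContinuousLinearMap.id ℝ _ := by
    rw [← matrixCLM_mul, ← matrixCLM_one, hB, Matrix.mul_assoc, Matrix.mul_assoc,
      ← Matrix.mul_assoc Jᵀ, Matrix.nonsing_inv_mul _ ((Matrix.isUnit_iff_isUnit_det _).1 hunit)]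
  -- Events determined by a neighbourhood of the limit have probability tending to one.
  have hprob : ∀ p : EuclideanSpace ℝ (Fin d) × EuclideanSpace ℝ (Fin k) → Prop,
      (∀ᶠ y in 𝓝 (A θ₀, θ₀), p y) →
      Tendsto (fun n => P {ω | ¬ p (V n ω, φ n (V n ω))}) atTop (𝓝 0) := by
    intro p hp
    obtain ⟨ε, hε, hball⟩ := Metric.eventually_nhds_iff.1 hp
    have h1 := tendsto_measure_compl_nhds_of_sqrt_smul hV hε
    have h2 := tendstoInMeasure_iff_norm.1 hφ ε hε
    have h12 := h1.add h2
    rw [add_zero] at h12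
    refine tendsto_of_tendsto_of_tendsto_of_le_of_le tendsto_const_nhds h12
      (fun n => zero_le) fun n => ?_
    refine (measure_mono fun ω hω => ?_).trans (measure_union_le _ _)
    by_contra hcon
    simp only [Set.mem_union, Set.mem_ofPred_eq, not_or, not_le] at hcon
    refine hω (hball ?_)
    rw [Prod.dist_eq, dist_eq_norm, dist_eq_norm]
    exact max_lt hcon.1 hcon.2
  have hexist := hprob _ hloc.eventually_exists_isMinOn
  refine ⟨?_, hunit, ?_, ?_⟩
  · refine hexist.congr' ?_
    filter_upwards [eventually_ge_atTop 1] with n hn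
    simp only [isMinimizer_estQuadChi_iff hn]
  · rw [hsand]
    simpa using (hC θ₀ hθ₀).mul_mul_conjTranspose_same B
  have hlin : TendstoInDistribution (fun (n : ℕ) ω => matrixCLM B (√(n : ℝ) • (V n ω - A θ₀)))
      atTop id (fun _ => P) (multivariateGaussian 0 (sandwich J (M θ₀) (C θ₀))) := by
    have h1 := hV.continuous_comp (matrixCLM B).continuous
    -- The continuous mapping theorem gives the limit as `matrixCLM B` under the old Gaussian; it is
    -- restated as `id` under the image Gaussian.
    refine ⟨h1.forall_aemeasurable, aemeasurable_id, ?_⟩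
    convert! h1.tendsto using 3
    refine congrArg 𝓝 (Subtype.ext ?_)
    change Measure.map id _ = Measure.map (matrixCLM B) _
    rw [Measure.map_id, hsand, map_matrixCLM_multivariateGaussian (hC θ₀ hθ₀)]
  refine tendstoInDistribution_of_tendstoInMeasure_sub _ _ hlin ?_
    fun n => ((hθm n).sub_const θ₀).const_smul √(n : ℝ)
  refine tendstoInMeasure_zero_of_norm_le hV fun ε hε => ?_
  have hev := hprob _ (hloc.eventually_exists_isMinOn.and
    (hloc.eventually_norm_minimizer_sub_le hL hLJ hε))
  refine tendsto_of_tendsto_of_tendsto_of_le_of_le' tendsto_const_nhds hev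
    (Eventually.of_forall fun n => zero_le) ?_
  filter_upwards [eventually_ge_atTop 1] with n hn
  -- Almost sure inclusion suffices, because `θhat` is a minimizer only almost surely; the bad
  -- events need not be measurable.
  refine measure_mono_ae ?_
  filter_upwards [hθhat n hn] with ω hω hbad hgood
  refine hbad ?_
  simp only [isMinimizer_estQuadChi_iff hn] at hω
  obtain ⟨hmem, hmin⟩ := hω hgood.1
  have hle := hgood.2 _ hmem hmin
  have heq : √(n : ℝ) • (θhat n ω - θ₀) - matrixCLM B (√(n : ℝ) • (V n ω - A θ₀)) =
      √(n : ℝ) • (θhat n ω - θ₀ - matrixCLM B (V n ω - A θ₀)) := by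
    rw [map_smul, ← smul_sub]
  simp only [Pi.sub_apply]
  rw [heq, norm_smul, norm_smul, mul_left_comm]
  exact mul_le_mul_of_nonneg_left hle (norm_nonneg _)
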